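/- For positive integers $m,k$ and a Boolean function $f:\{0,1\}^m\to\{0,1\}$ with exactly $k$ zeros, let $M_f$ be the $k\times m$ matrix whose rows are the distinct zeros of $f$. Let $\Phi^{m,k}$ be the set of those $f$ with exactly $k$ zeros that are reduced (no column of $M_f$ is constant, no two columns are equal, and no column is the coordinatewise negation of another one), that have no two zeros at Hamming distance $1$, and for which in each column of $M_f$ the number of ones does not exceed the number of zeros. A minimal DNF of $f$ is a disjunctive normal form of $f$ with the least number of literals, counted with repetitions. Let $\log$ be the natural logarithm, fix $0<\alpha<1$ and put $\lambda=\lambda_{m,k}=\alpha\sqrt{2\log m/k}$. "Almost all functions of $\Phi^{m,k}$" means that, as $m\to\infty$, the proportion of functions in $\Phi^{m,k}$ with the property tends to $1$, uniformly over all $k$ in the stated range for which $\Phi^{m,k}\neq\varnothing$. (i) For $\log m\le k/32$, for almost all functions of $\Phi^{m,k}$ every minimal DNF contains at least $$\frac{10}{3}m-\frac{5m(1-\lambda)}{3+3\lambda}$$ literals. (ii) For $k/162<\log m<k/32$, for almost all functions of $\Phi^{m,k}$ every minimal DNF contains at least $$\frac{10}{3}m-\frac{13m(1-\lambda)}{9+3\lambda}$$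 literals. -/

import Mathlib

namespace DNFBound

/-- Boolean functions of `m` variables. -/
abbrev BoolFun (m : ℕ) : Type := (Fin m → Bool) → Bool

/-- The zeros of `f`; they index the rows of its matrix of zeros. -/
abbrev Zero {m : ℕ} (f : BoolFun m) : Type := {x : Fin m → Bool // f x = false}

/-- The matrix of zeros `M_f`: its rows are the distinct zeros of `f`, its columns correspond to
the variables. -/
def zeroMatrix {m : ℕ} (f : BoolFun m) : Matrix (Zero f) (Fin m) Bool :=
  Matrix.of fun z i => z.1 i

/-- The `i`-th column of the matrix of zeros. -/
def zeroColumn {m : ℕ} (f : BoolFun m) (i : Fin m) : Zero f → Bool :=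
  fun z => zeroMatrix f z i

/-- The number of entries of the `i`-th column of the matrix of zeros that are equal to `b`. -/
def columnCount {m : ℕ} (f : BoolFun m) (i : Fin m) (b : Bool) : ℕ :=
  Fintype.card {z : Zero f // zeroColumn f i z = b}

/-- A reduced function: the matrix of zeros has no constant column, no two of its columns are
equal, and no column is the negation of another one. (Equal columns being absent, the requirement
that equal columns stand next to each other is void.) -/
structure IsReduced {m : ℕ} (f : BoolFun m) : Prop where
  not_constant : ∀ (i : Fin m) (b : Bool), zeroColumn f i ≠ fun _ => b
  distinct : ∀ i j : Fin m, i ≠ j → zeroColumn f i ≠ zeroColumn f j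
  not_complementary : ∀ i j : Fin m, i ≠ j → zeroColumn f i ≠ fun z => !(zeroColumn f j z)

/-- The class `Φ^{m,k}`: reduced functions of `m` variables with exactly `k` zeros, no two of which
are at Hamming distance 1, normalized so that in every column of the matrix of zeros the number of
ones does not exceed the number of zeros. -/
def Phi (m k : ℕ) : Set (BoolFun m) :=
  {f | IsReduced f ∧ Fintype.card (Zero f) = k ∧
    (∀ y z : Zero f, hammingDist y.1 z.1 ≠ 1) ∧
    ∀ i : Fin m, columnCount f i true ≤ columnCount f i false}

/-- An elementary conjunction in `m` variables: `K i = some true` if it contains the literal `x_i`,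
`K i = some false` if it contains the negated literal, `K i = none` if `x_i` does not occur. -/
abbrev Conjunction (m : ℕ) : Type := Fin m → Option Bool

/-- `K` takes the value 1 at the point `x`. -/
def Conjunction.Holds {m : ℕ} (K : Conjunction m) (x : Fin m → Bool) : Prop :=
  ∀ (i : Fin m) (b : Bool), K i = some b → x i = b

/-- The number of literals of a conjunction. -/
def Conjunction.rank {m : ℕ} (K : Conjunction m) : ℕ :=
  Fintype.card {i : Fin m // K i ≠ none}

/-- A disjunctive normal form: a finite set of elementary conjunctions. -/
abbrev DNF (m : ℕ) : Type := Finset (Conjunction m)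

/-- The rank of a DNF: the number of literals in it, counted with repetitions. -/
def DNF.rank {m : ℕ} (D : DNF m) : ℕ := ∑ K ∈ D, Conjunction.rank K

/-- `D` is a DNF of the function `f`. -/
def DNF.Realizes {m : ℕ} (D : DNF m) (f : BoolFun m) : Prop :=
  ∀ x : Fin m → Bool, f x = true ↔ ∃ K ∈ D, Conjunction.Holds K x

/-- `D` is a minimal DNF of `f`: a DNF of `f` of least rank. -/
def DNF.IsMinimal {m : ℕ} (D : DNF m) (f : BoolFun m) : Prop :=
  DNF.Realizes D f ∧ ∀ D' : DNF m, DNF.Realizes D' f → DNF.rank D ≤ DNF.rank D'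

/-- Almost all functions of `Φ^{m,k}` with `(m, k)` in the range `R` have the property `P`: as
`m → ∞`, the proportion of functions with the property tends to 1, uniformly over the `k` that
satisfy `R m k`. -/
def AlmostAll (R : ℕ → ℕ → Prop) (P : (m k : ℕ) → BoolFun m → Prop) : Prop :=
  ∀ δ : ℝ, 0 < δ → ∃ M : ℕ, ∀ m k : ℕ, M ≤ m → R m k →
    (1 - δ) * ((Phi m k).ncard : ℝ) ≤ (({f | f ∈ Phi m k ∧ P m k f} : Set (BoolFun m)).ncard : ℝ)

/-- The quantity `λ = α √(2 log m / k)`, with the natural logarithm. -/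
noncomputable def lam (α : ℝ) (m k : ℕ) : ℝ :=
  α * Real.sqrt (2 * Real.log (m : ℝ) / (k : ℝ))

end DNFBound

/-!
If `z` is a zero of `f` and no zero is at distance 1 from it, then a DNF of `f` must cover the
neighbour of `z` in direction `i`, by a conjunction which contains the literal of `x_i` that fails
at `z` and whose other literals all hold at `z`. Hence each of the `2m` literals occurs. Suppose
moreover that no column of the matrix of zeros is constant on the zeros of another column. A
conjunction `K` containing `x_i` fails at a zero with `x_i = 1`, so it contains a literal of some
other variable `x_j`; that literal fails at a zero `z` with `z_i = 0`, and the neighbour of `z` in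
direction `i` needs a second conjunction containing `x_i`. So `x_i` occurs twice and every DNF has
at least `3m` literals.

Almost all functions satisfy this independence condition when `12 log m ≤ k = O(m)`. Labelling the
zeros turns functions into sequences of `m` columns of length `k`, `k!` sequences for each function.
Among the `h ^ m` sequences of columns with at most as many ones as zeros, where `h ≥ 2 ^ (k - 1)`,
at most a fraction `8 m² (3/4) ^ k` violate independence and at most a fraction
`k² m (3/4) ^ (m - 1)` have two rows at distance at most 1; all the others come from functions of
`Φ^{m,k}`, since independence also excludes constant, equal and complementary columns.

For `k ≥ 578 log m` one has `λ ≤ 1/17`, and the bound in the theorem is at most `2m`; for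
`k ≥ 12 log m` one has `λ ≤ 1/2`, and it is at most `3m`.
-/

namespace DNFBound

open Finset Filter Topology
open scoped Nat

section Matrices

variable {κ ι ι' : Type*} {A : κ → ι → Bool}

/-- A Boolean matrix, given as a family of columns, in which no column is constant on the set of
zeros of another column. -/
def ZeroIndependent (A : κ → ι → Bool) : Prop :=
  ∀ i j, i ≠ j → ∀ b : Bool, ∃ r, A i r = false ∧ A j r ≠ b

/-- A Boolean matrix, given as a family of columns, any two rows of which differ in at least two
places. -/
def RowSeparated [Fintype κ] (A : κ → ι → Bool) : Prop :=
  Pairwise fun r s => 1 < hammingDist (fun i => A i r) (fun i => A i s)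

theorem ZeroIndependent.ne_const [Nontrivial κ] (hA : ZeroIndependent A) (i : κ) (b : Bool) :
    A i ≠ fun _ => b := by
  obtain ⟨j, hj⟩ := exists_ne i
  obtain ⟨r, -, hr⟩ := hA j i hj b
  exact fun h => hr (congrFun h r)

theorem ZeroIndependent.ne (hA : ZeroIndependent A) {i j : κ} (hij : i ≠ j) : A i ≠ A j := by
  obtain ⟨r, hi, hj⟩ := hA i j hij false
  exact fun h => hj (h ▸ hi)

theorem ZeroIndependent.ne_not (hA : ZeroIndependent A) {i j : κ} (hij : i ≠ j) :
    A i ≠ fun r => !A j r := by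
  obtain ⟨r, hi, hj⟩ := hA i j hij true
  intro h
  exact hj (by simpa [hi] using congrFun h r)

theorem ZeroIndependent.of_comp (e : ι' → ι) (h : ZeroIndependent fun i => A i ∘ e) :
    ZeroIndependent A := fun i j hij b =>
  let ⟨r, hr⟩ := h i j hij b
  ⟨e r, hr⟩

theorem RowSeparated.injective [Fintype κ] (hA : RowSeparated A) :
    Function.Injective fun r i => A i r := by
  intro r s (hrs : (fun i => A i r) = fun i => A i s)
  by_contra hne
  have hdist : 1 < hammingDist (fun i => A i r) (fun i => A i s) := hA hne
  rw [hrs, hammingDist_self] at hdist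
  omega

end Matrices

section RankBounds

variable {m : ℕ} {f : BoolFun m} {D : DNF m}

/-- The number of conjunctions of `D` that contain the literal of `x_i` with sign `b`. -/
def DNF.occurrences (D : DNF m) (i : Fin m) (b : Bool) : ℕ :=
  #{K ∈ D | K i = some b}

theorem DNF.rank_eq_sum_occurrences (D : DNF m) :
    D.rank = ∑ i, (D.occurrences i true + D.occurrences i false) := by
  have rank_eq (K : Conjunction m) : K.rank =
      ∑ i, ((if K i = some true then 1 else 0) + (if K i = some false then 1 else 0)) := by
    rw [Conjunction.rank, Fintype.card_subtype, card_filter]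
    refine sum_congr rfl fun i _ => ?_
    rcases K i with _ | _ | _ <;> simp
  simp only [DNF.rank, rank_eq, DNF.occurrences, card_filter, ← sum_add_distrib]
  exact sum_comm

theorem DNF.mul_le_rank {c : ℕ} (h : ∀ i, c ≤ D.occurrences i true + D.occurrences i false) :
    c * m ≤ D.rank := by
  rw [DNF.rank_eq_sum_occurrences]
  simpa [mul_comm] using card_nsmul_le_sum univ _ c fun i _ => h i

theorem hammingDist_update_not (x : Fin m → Bool) (i : Fin m) :
    hammingDist x (Function.update x i (!x i)) = 1 := by
  rw [hammingDist, card_eq_one]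
  refine ⟨i, ?_⟩
  ext j
  rcases eq_or_ne j i with rfl | h <;> simp [*]

theorem DNF.Realizes.not_holds (hD : D.Realizes f) {K : Conjunction m} (hK : K ∈ D) (z : Zero f) :
    ¬ K.Holds z.1 := fun h =>
  Bool.false_ne_true (z.2.symm.trans ((hD z.1).2 ⟨K, hK, h⟩))

theorem DNF.Realizes.exists_mem_covering_neighbour (hD : D.Realizes f)
    (hf : ∀ y z : Zero f, hammingDist y.1 z.1 ≠ 1) (z : Zero f) (i : Fin m) :
    ∃ K ∈ D, K i = some (!z.1 i) ∧ ∀ j ≠ i, ∀ b, K j = some b → z.1 j = b := by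
  have neighbour_one : f (Function.update z.1 i (!z.1 i)) = true := by
    by_contra h
    exact hf z ⟨_, Bool.eq_false_of_not_eq_true h⟩ (hammingDist_update_not z.1 i)
  obtain ⟨K, hK, holds⟩ := (hD _).1 neighbour_one
  have agree : ∀ j ≠ i, ∀ b, K j = some b → z.1 j = b := fun j hj b hb => by
    simpa [hj] using holds j b hb
  refine ⟨K, hK, ?_, agree⟩
  by_contra hi
  refine hD.not_holds hK z fun j b hb => ?_
  rcases eq_or_ne j i with rfl | hj
  · have : (!z.1 j) = b := by simpa using holds j b hb
    exact absurd (this ▸ hb) hi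
  · exact agree j hj b hb

theorem exists_zero_apply_eq {i : Fin m} (h : ∀ b : Bool, zeroColumn f i ≠ fun _ => b) (b : Bool) :
    ∃ z : Zero f, z.1 i = b := by
  by_contra! hz
  exact h (!b) (funext fun z => Bool.eq_not_of_ne (hz z))

theorem DNF.Realizes.one_le_occurrences (hD : D.Realizes f)
    (hf : ∀ y z : Zero f, hammingDist y.1 z.1 ≠ 1) {i : Fin m}
    (hi : ∀ b : Bool, zeroColumn f i ≠ fun _ => b) (b : Bool) : 1 ≤ D.occurrences i b := by
  obtain ⟨z, hz⟩ := exists_zero_apply_eq hi (!b)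
  obtain ⟨K, hK, hKi, -⟩ := hD.exists_mem_covering_neighbour hf z i
  rw [hz, Bool.not_not] at hKi
  exact card_pos.2 ⟨K, mem_filter.2 ⟨hK, hKi⟩⟩

theorem DNF.Realizes.two_le_occurrences (hD : D.Realizes f)
    (hf : ∀ y z : Zero f, hammingDist y.1 z.1 ≠ 1) {i : Fin m}
    (hi : ∀ b : Bool, zeroColumn f i ≠ fun _ => b) (hind : ZeroIndependent (zeroColumn f)) :
    2 ≤ D.occurrences i true := by
  have covering (z : Zero f) (hz : z.1 i = false) :
      ∃ K ∈ D, K i = some true ∧ ∀ j ≠ i, ∀ b, K j = some b → z.1 j = b := by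
    simpa [hz] using hD.exists_mem_covering_neighbour hf z i
  obtain ⟨z₀, hz₀⟩ := exists_zero_apply_eq hi false
  obtain ⟨z₁, hz₁⟩ := exists_zero_apply_eq hi true
  obtain ⟨K, hK, hKi, -⟩ := covering z₀ hz₀
  obtain ⟨j, b, hKj, hz₁j⟩ : ∃ j b, K j = some b ∧ z₁.1 j ≠ b := by
    simpa only [Conjunction.Holds, not_forall, exists_prop] using hD.not_holds hK z₁
  have hij : i ≠ j := by
    rintro rfl
    rw [hKi, Option.some_inj] at hKj
    exact hz₁j (hz₁.trans hKj)
  obtain ⟨z, hzi, hzj⟩ := hind i j hij b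
  obtain ⟨K', hK', hKi', hagree⟩ := covering z hzi
  refine one_lt_card.2 ⟨K, mem_filter.2 ⟨hK, hKi⟩, K', mem_filter.2 ⟨hK', hKi'⟩, ?_⟩
  rintro rfl
  exact hzj (hagree j hij.symm b hKj)

theorem DNF.Realizes.two_mul_le_rank (hD : D.Realizes f)
    (hf : ∀ y z : Zero f, hammingDist y.1 z.1 ≠ 1)
    (hconst : ∀ (i : Fin m) (b : Bool), zeroColumn f i ≠ fun _ => b) : 2 * m ≤ D.rank :=
  DNF.mul_le_rank fun i =>
    add_le_add (hD.one_le_occurrences hf (hconst i) true)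
      (hD.one_le_occurrences hf (hconst i) false)

theorem DNF.Realizes.three_mul_le_rank (hD : D.Realizes f)
    (hf : ∀ y z : Zero f, hammingDist y.1 z.1 ≠ 1)
    (hconst : ∀ (i : Fin m) (b : Bool), zeroColumn f i ≠ fun _ => b)
    (hind : ZeroIndependent (zeroColumn f)) : 3 * m ≤ D.rank :=
  DNF.mul_le_rank fun i =>
    add_le_add (hD.two_le_occurrences hf (hconst i) hind)
      (hD.one_le_occurrences hf (hconst i) false)

end RankBounds

section LightColumns

variable {ι ι' : Type*} [Fintype ι] [DecidableEq ι] [Fintype ι'] [DecidableEq ι']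

variable (ι) in
/-- The columns with rows indexed by `ι` that have at most as many ones as zeros. -/
def lightColumns : Finset (ι → Bool) :=
  {c | Fintype.card {r // c r = true} ≤ Fintype.card {r // c r = false}}

theorem mem_lightColumns {c : ι → Bool} : c ∈ lightColumns ι ↔
    Fintype.card {r // c r = true} ≤ Fintype.card {r // c r = false} := by
  simp [lightColumns]

theorem comp_equiv_mem_lightColumns (e : ι ≃ ι') {c : ι' → Bool} :
    c ∘ e ∈ lightColumns ι ↔ c ∈ lightColumns ι' := by
  have count_eq (b : Bool) :
      Fintype.card {r // (c ∘ e) r = b} = Fintype.card {r // c r = b} :=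
    Fintype.card_congr (e.subtypeEquiv fun _ => Iff.rfl)
  rw [mem_lightColumns, mem_lightColumns, count_eq, count_eq]

theorem mem_or_not_mem_lightColumns (c : ι → Bool) :
    c ∈ lightColumns ι ∨ (fun r => !c r) ∈ lightColumns ι := by
  simpa [mem_lightColumns] using
    le_total (Fintype.card {r // c r = true}) (Fintype.card {r // c r = false})

theorem card_filter_le_two_mul_card_lightColumns_filter (p : (ι → Bool) → Prop) [DecidablePred p]
    (hp : ∀ c, p c → p fun r => !c r) :
    #{c | p c} ≤ 2 * #{c ∈ lightColumns ι | p c} := by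
  have subset : ({c | p c} : Finset (ι → Bool)) ⊆
      {c ∈ lightColumns ι | p c} ∪ {c ∈ lightColumns ι | p c}.image fun c r => !c r := by
    intro c hc
    have hpc : p c := by simpa using hc
    rcases mem_or_not_mem_lightColumns c with h | h
    · exact mem_union_left _ (mem_filter.2 ⟨h, hpc⟩)
    · exact mem_union_right _ (mem_image.2 ⟨_, mem_filter.2 ⟨h, hp c hpc⟩, by simp⟩)
  calc #{c | p c} ≤ _ := card_le_card subset
    _ ≤ #{c ∈ lightColumns ι | p c} + #{c ∈ lightColumns ι | p c} :=
      (card_union_le _ _).trans (Nat.add_le_add_left card_image_le _)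
    _ = _ := (two_mul _).symm

theorem two_pow_le_two_mul_card_lightColumns : 2 ^ Fintype.card ι ≤ 2 * #(lightColumns ι) := by
  simpa using card_filter_le_two_mul_card_lightColumns_filter (ι := ι) (fun _ => True)
    fun _ _ => trivial

theorem four_pow_le_four_mul_card_lightColumns_sq :
    (4 : ℝ) ^ Fintype.card ι ≤ 4 * (#(lightColumns ι) : ℝ) ^ 2 := by
  calc (4 : ℝ) ^ Fintype.card ι = (2 ^ Fintype.card ι) ^ 2 := by
        rw [pow_right_comm]
        norm_num
    _ ≤ (2 * #(lightColumns ι)) ^ 2 := by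
        gcongr
        exact_mod_cast two_pow_le_two_mul_card_lightColumns
    _ = _ := by ring

theorem two_pow_le_two_mul_card_filter_apply_ne {r s : ι} (hrs : r ≠ s) :
    2 ^ Fintype.card ι ≤ 2 * #{c : ι → Bool | c r ≠ c s} := by
  have flip : #{c : ι → Bool | c r = c s} ≤ #{c : ι → Bool | c r ≠ c s} := by
    refine card_le_card_of_injOn (fun c => Function.update c r (!c r)) (fun c hc => ?_)
      fun c _ d _ h => ?_
    · have : c r = c s := by simpa using hc
      simp [hrs.symm, this]
    · funext t
      have := congrFun h t
      rcases eq_or_ne t r with rfl | ht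
      · simpa using this
      · simpa [ht] using this
  have split := card_filter_add_card_filter_not (s := (univ : Finset (ι → Bool)))
    fun c => c r = c s
  simp only [card_univ, Fintype.card_pi, Fintype.card_bool, prod_const, ← ne_eq] at split
  omega

theorem card_lightColumns_filter_apply_eq_le {r s : ι} (hrs : r ≠ s) :
    (#{c ∈ lightColumns ι | c r = c s} : ℝ) ≤ 3 / 4 * #(lightColumns ι) := by
  have differ := two_pow_le_two_mul_card_filter_apply_ne hrs
  have light := card_filter_le_two_mul_card_lightColumns_filter (fun c : ι → Bool => c r ≠ c s)
    fun c hc => by simpa using hc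
  have split := card_filter_add_card_filter_not (s := lightColumns ι) fun c => c r = c s
  have total : #(lightColumns ι) ≤ 2 ^ Fintype.card ι := by
    simpa using card_le_univ (lightColumns ι)
  simp only [← ne_eq] at split
  have : 4 * #{c ∈ lightColumns ι | c r = c s} ≤ 3 * #(lightColumns ι) := by omega
  have : 4 * (#{c ∈ lightColumns ι | c r = c s} : ℝ) ≤ 3 * #(lightColumns ι) := by
    exact_mod_cast this
  linarith

end LightColumns

section UnionBounds

variable {κ γ ι : Type*} [Fintype κ] [DecidableEq κ] [DecidableEq γ] [Fintype ι] [DecidableEq ι]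

theorem card_piFinset_filter_pair_mem_mul_sq_le (H : Finset γ) (R : Finset (γ × γ)) {i j : κ}
    (hij : i ≠ j) :
    #{A ∈ Fintype.piFinset fun _ : κ => H | (A i, A j) ∈ R} * #H ^ 2 ≤
      #R * #H ^ Fintype.card κ := by
  have card_tuples : #H ^ Fintype.card κ = #(Fintype.piFinset fun _ : κ => H) := by simp
  rw [card_tuples, sq, ← card_product, ← card_product, ← card_product]
  refine card_le_card_of_injOn
    (fun p => ((p.1 i, p.1 j), Function.update (Function.update p.1 i p.2.1) j p.2.2)) ?_ ?_
  · rintro ⟨A, u, v⟩ h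
    simp only [coe_product, Set.mem_prod, mem_coe, mem_filter, Fintype.mem_piFinset] at h ⊢
    refine ⟨h.1.2, fun l => ?_⟩
    rcases eq_or_ne l j with rfl | hj
    · simpa using h.2.2
    rcases eq_or_ne l i with rfl | hi
    · simpa [hj] using h.2.1
    · simpa [hi, hj] using h.1.1 l
  · rintro ⟨A, u, v⟩ - ⟨B, u', v'⟩ - h
    simp only [Prod.mk.injEq] at h
    obtain ⟨⟨eq_i, eq_j⟩, eq_update⟩ := h
    have hu : u = u' := by simpa [hij] using congrFun eq_update i
    have hv : v = v' := by simpa using congrFun eq_update j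
    have hA : A = B := by
      funext l
      rcases eq_or_ne l j with rfl | hj
      · exact eq_j
      rcases eq_or_ne l i with rfl | hi
      · exact eq_i
      · simpa [hi, hj] using congrFun eq_update l
    rw [hu, hv, hA]

theorem card_piFinset_filter_exists_pair_mem_mul_sq_le (H : Finset γ) (R : Finset (γ × γ)) :
    #{A ∈ Fintype.piFinset fun _ : κ => H | ∃ i j, i ≠ j ∧ (A i, A j) ∈ R} * #H ^ 2 ≤
      Fintype.card κ ^ 2 * #R * #H ^ Fintype.card κ := by
  have subset : {A ∈ Fintype.piFinset fun _ : κ => H | ∃ i j, i ≠ j ∧ (A i, A j) ∈ R} ⊆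
      (univ.offDiag : Finset (κ × κ)).biUnion fun t =>
        {A ∈ Fintype.piFinset fun _ : κ => H | (A t.1, A t.2) ∈ R} := by
    intro A hA
    obtain ⟨hA, i, j, hij, hR⟩ := mem_filter.1 hA
    exact mem_biUnion.2 ⟨(i, j), by simpa using hij, mem_filter.2 ⟨hA, hR⟩⟩
  calc _ ≤ (∑ t ∈ (univ.offDiag : Finset (κ × κ)),
          #{A ∈ Fintype.piFinset fun _ : κ => H | (A t.1, A t.2) ∈ R}) * #H ^ 2 :=
        Nat.mul_le_mul_right _ ((card_le_card subset).trans card_biUnion_le)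
    _ ≤ #(univ.offDiag : Finset (κ × κ)) * (#R * #H ^ Fintype.card κ) := by
        rw [sum_mul, ← smul_eq_mul]
        refine sum_le_card_nsmul _ _ _ fun t ht => ?_
        exact card_piFinset_filter_pair_mem_mul_sq_le H R (mem_offDiag.1 ht).2.2
    _ ≤ Fintype.card κ ^ 2 * (#R * #H ^ Fintype.card κ) := by
        gcongr
        simp [sq]
    _ = _ := (mul_assoc _ _ _).symm

theorem card_filter_const_on_zeros (b : Bool) :
    #{p : (ι → Bool) × (ι → Bool) | ∀ r, p.1 r = false → p.2 r = b} = 3 ^ Fintype.card ι := by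
  have pointwise : #{q : Bool × Bool | q.1 = false → q.2 = b} = 3 := by cases b <;> decide
  have card_pi : 3 ^ Fintype.card ι =
      #(Fintype.piFinset fun _ : ι => {q : Bool × Bool | q.1 = false → q.2 = b}) := by
    simp [pointwise]
  rw [card_pi]
  refine card_equiv (Equiv.arrowProdEquivProdArrow ι _ _).symm fun p => ?_
  simp [Fintype.mem_piFinset]

omit [DecidableEq ι] in
open scoped Classical in
theorem card_piFinset_not_zeroIndependent_mul_sq_le (H : Finset (ι → Bool)) :
    #{A ∈ Fintype.piFinset fun _ : κ => H | ¬ ZeroIndependent A} * #H ^ 2 ≤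
      Fintype.card κ ^ 2 * (2 * 3 ^ Fintype.card ι) * #H ^ Fintype.card κ := by
  let forced (b : Bool) : Finset ((ι → Bool) × (ι → Bool)) := {p | ∀ r, p.1 r = false → p.2 r = b}
  have card_forced : #(univ.biUnion forced) ≤ 2 * 3 ^ Fintype.card ι :=
    card_biUnion_le_card_mul _ _ _ fun b _ => (card_filter_const_on_zeros b).le
  refine le_trans (Nat.mul_le_mul_right _ (card_le_card ?_))
    ((card_piFinset_filter_exists_pair_mem_mul_sq_le H (univ.biUnion forced)).trans (by gcongr))
  refine monotone_filter_right _ fun A _ (hA : ¬ ZeroIndependent A) => ?_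
  rw [ZeroIndependent] at hA
  push Not at hA
  obtain ⟨i, j, hij, b, hb⟩ := hA
  exact ⟨i, j, hij, mem_biUnion.2 ⟨b, mem_univ b, mem_filter.2 ⟨mem_univ _, hb⟩⟩⟩

open scoped Classical in
theorem card_lightColumns_not_zeroIndependent_le :
    (#{A ∈ Fintype.piFinset fun _ : κ => lightColumns ι | ¬ ZeroIndependent A} : ℝ) ≤
      8 * (Fintype.card κ : ℝ) ^ 2 * (3 / 4) ^ Fintype.card ι *
        (#(lightColumns ι) : ℝ) ^ Fintype.card κ := by
  have four_pow_le := four_pow_le_four_mul_card_lightColumns_sq (ι := ι)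
  have pairs := card_piFinset_not_zeroIndependent_mul_sq_le (κ := κ) (lightColumns ι)
  set k := Fintype.card ι
  set h := #(lightColumns ι)
  have h_sq_pos : (0 : ℝ) < (h : ℝ) ^ 2 := by linarith [pow_pos (four_pos : (0 : ℝ) < 4) k]
  refine le_of_mul_le_mul_right ?_ h_sq_pos
  calc (#{A ∈ Fintype.piFinset fun _ : κ => lightColumns ι | ¬ ZeroIndependent A} : ℝ) * h ^ 2
      ≤ (Fintype.card κ : ℝ) ^ 2 * (2 * 3 ^ k) * h ^ Fintype.card κ := by exact_mod_cast pairs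
    _ = 2 * (Fintype.card κ : ℝ) ^ 2 * (3 / 4) ^ k * h ^ Fintype.card κ * 4 ^ k := by
      rw [div_pow]
      field_simp
    _ ≤ 2 * (Fintype.card κ : ℝ) ^ 2 * (3 / 4) ^ k * h ^ Fintype.card κ * (4 * h ^ 2) := by gcongr
    _ = _ := by ring

theorem card_lightColumns_agree_off_le {r s : ι} (hrs : r ≠ s) (j : κ) :
    (#{A ∈ Fintype.piFinset fun _ : κ => lightColumns ι | ∀ i ≠ j, A i r = A i s} : ℝ) ≤
      (3 / 4) ^ (Fintype.card κ - 1) * (#(lightColumns ι) : ℝ) ^ Fintype.card κ := by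
  set h := #(lightColumns ι)
  have eq_pi : {A ∈ Fintype.piFinset fun _ : κ => lightColumns ι | ∀ i ≠ j, A i r = A i s} =
      Fintype.piFinset (Function.update (fun _ : κ => {c ∈ lightColumns ι | c r = c s}) j
        (lightColumns ι)) := by
    ext A
    simp only [mem_filter, Fintype.mem_piFinset, ← forall_and]
    refine forall_congr' fun i => ?_
    rcases eq_or_ne i j with rfl | hi <;> simp [*]
  have card_ne_zero : Fintype.card κ ≠ 0 := (Fintype.card_pos_iff.2 ⟨j⟩).ne'
  calc _ = (h * #{c ∈ lightColumns ι | c r = c s} ^ (Fintype.card κ - 1) : ℝ) := by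
        rw [eq_pi, Fintype.card_piFinset, ← mul_prod_erase univ _ (mem_univ j),
          Function.update_self, prod_congr rfl (g := fun _ => #{c ∈ lightColumns ι | c r = c s})
            fun i hi => by rw [Function.update_of_ne (ne_of_mem_erase hi)]]
        simp [h]
    _ ≤ h * (3 / 4 * h) ^ (Fintype.card κ - 1) := by
        gcongr
        exact card_lightColumns_filter_apply_eq_le hrs
    _ = (3 / 4) ^ (Fintype.card κ - 1) * (h * h ^ (Fintype.card κ - 1)) := by
        rw [mul_pow]
        ring
    _ = _ := by rw [mul_pow_sub_one card_ne_zero]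

open scoped Classical in
theorem card_lightColumns_not_rowSeparated_le [Nonempty κ] :
    (#{A ∈ Fintype.piFinset fun _ : κ => lightColumns ι | ¬ RowSeparated A} : ℝ) ≤
      (Fintype.card ι : ℝ) ^ 2 * Fintype.card κ * (3 / 4) ^ (Fintype.card κ - 1) *
        (#(lightColumns ι) : ℝ) ^ Fintype.card κ := by
  set bound : ℝ := (3 / 4) ^ (Fintype.card κ - 1) * (#(lightColumns ι) : ℝ) ^ Fintype.card κ
  let close (t : (ι × ι) × κ) : Finset (κ → ι → Bool) :=
    {A ∈ Fintype.piFinset fun _ : κ => lightColumns ι | ∀ i ≠ t.2, A i t.1.1 = A i t.1.2}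
  have subset : {A ∈ Fintype.piFinset fun _ : κ => lightColumns ι | ¬ RowSeparated A} ⊆
      (univ.offDiag ×ˢ univ : Finset ((ι × ι) × κ)).biUnion close := by
    intro A hA
    obtain ⟨hA, hsep⟩ := mem_filter.1 hA
    simp only [RowSeparated, Pairwise] at hsep
    push Not at hsep
    obtain ⟨r, s, hrs, hdist⟩ := hsep
    obtain ⟨j, hj⟩ := card_le_one_iff_subset_singleton.1 hdist
    refine mem_biUnion.2 ⟨((r, s), j), by simpa using hrs, mem_filter.2 ⟨hA, fun i hi => ?_⟩⟩
    by_contra hne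
    exact hi (mem_singleton.1 (hj (mem_filter.2 ⟨mem_univ i, hne⟩)))
  have card_pairs : #(univ.offDiag ×ˢ univ : Finset ((ι × ι) × κ)) ≤
      Fintype.card ι ^ 2 * Fintype.card κ := by
    simpa [sq] using card_le_univ (univ.offDiag ×ˢ univ : Finset ((ι × ι) × κ))
  calc (#{A ∈ Fintype.piFinset fun _ : κ => lightColumns ι | ¬ RowSeparated A} : ℝ)
      ≤ ∑ t ∈ (univ.offDiag ×ˢ univ : Finset ((ι × ι) × κ)), (#(close t) : ℝ) := by
        exact_mod_cast (card_le_card subset).trans card_biUnion_le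
    _ ≤ #(univ.offDiag ×ˢ univ : Finset ((ι × ι) × κ)) * bound := by
        rw [← nsmul_eq_mul]
        refine sum_le_card_nsmul _ _ _ fun t ht => ?_
        exact card_lightColumns_agree_off_le (mem_offDiag.1 (mem_product.1 ht).1).2.2 t.2
    _ ≤ (Fintype.card ι ^ 2 * Fintype.card κ : ℝ) * bound := by
        gcongr
        exact_mod_cast card_pairs
    _ = _ := (mul_assoc _ _ _).symm

end UnionBounds

section Labellings

variable {m k : ℕ}

/-- The labelled matrices of zeros of the functions in `S`: the matrices with `k` rows, given as
families of columns, that arise from an enumeration of the zeros of some `f ∈ S`. -/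
def labelledMatrices (k : ℕ) (S : Set (BoolFun m)) : Set (Fin m → Fin k → Bool) :=
  {A | ∃ f ∈ S, ∃ e : Fin k ≃ Zero f, A = fun i => zeroColumn f i ∘ e}

theorem labelling_injective : Function.Injective
    fun (p : Σ f : BoolFun m, Fin k ≃ Zero f) (i : Fin m) => zeroColumn p.1 i ∘ p.2 := by
  rintro ⟨f, e⟩ ⟨g, e'⟩ h
  have rows_eq (r : Fin k) : (e r).1 = (e' r).1 := funext fun i => congrFun (congrFun h i) r
  have zero_iff (x : Fin m → Bool) : f x = false ↔ g x = false := by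
    constructor <;> intro hx
    · obtain ⟨r, hr⟩ := e.surjective ⟨x, hx⟩
      rw [show x = (e' r).1 by rw [← rows_eq, hr]]
      exact (e' r).2
    · obtain ⟨r, hr⟩ := e'.surjective ⟨x, hx⟩
      rw [show x = (e r).1 by rw [rows_eq, hr]]
      exact (e r).2
  obtain rfl : f = g := funext fun x => by
    simpa using congrArg not (Bool.eq_iff_iff.2 (by simpa using zero_iff x))
  obtain rfl : e = e' := Equiv.ext fun r => Subtype.ext (rows_eq r)
  rfl

theorem ncard_labelledMatrices {S : Set (BoolFun m)}
    (hS : ∀ f ∈ S, Fintype.card (Zero f) = k) :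
    (labelledMatrices k S).ncard = S.ncard * k ! := by
  have eq_range : labelledMatrices k S = Set.range
      fun (p : Σ f : S, Fin k ≃ Zero f.1) (i : Fin m) => zeroColumn p.1.1 i ∘ p.2 := by
    ext A
    constructor
    · rintro ⟨f, hf, e, rfl⟩
      exact ⟨⟨⟨f, hf⟩, e⟩, rfl⟩
    · rintro ⟨⟨f, e⟩, rfl⟩
      exact ⟨f.1, f.2, e, rfl⟩
  have injective : Function.Injective
      fun (p : Σ f : S, Fin k ≃ Zero f.1) (i : Fin m) => zeroColumn p.1.1 i ∘ p.2 :=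
    labelling_injective.comp (Subtype.val_injective.sigma_map fun _ => Function.injective_id)
  have card_labellings (f : S) : Nat.card (Fin k ≃ Zero f.1) = k ! := by
    have e : Fin k ≃ Zero f.1 := Fintype.equivOfCardEq (by rw [hS f f.2, Fintype.card_fin])
    rw [Nat.card_eq_fintype_card, Fintype.card_equiv e, Fintype.card_fin]
  have := Fintype.ofFinite S
  rw [eq_range, ← Nat.card_coe_set_eq, Nat.card_range_of_injective injective, Nat.card_sigma]
  simp only [card_labellings, sum_const, card_univ, smul_eq_mul]
  rw [← Nat.card_eq_fintype_card, Nat.card_coe_set_eq]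

theorem exists_equiv_zero_of_injective {ι : Type*} [Finite ι] {row : ι → Fin m → Bool}
    (hrow : Function.Injective row) :
    ∃ (f : BoolFun m) (e : ι ≃ Zero f), ∀ r, (e r).1 = row r := by
  classical
  let f : BoolFun m := fun x => decide (x ∉ Set.range row)
  refine ⟨f, (Equiv.ofInjective row hrow).trans (Equiv.subtypeEquivRight fun x => ?_),
    fun r => rfl⟩
  simp [f]

theorem mem_Phi_of_labelling {f : BoolFun m} (hm : 2 ≤ m) (e : Fin k ≃ Zero f)
    (hlight : ∀ i, zeroColumn f i ∘ e ∈ lightColumns (Fin k))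
    (hind : ZeroIndependent (zeroColumn f))
    (hsep : RowSeparated fun i => zeroColumn f i ∘ e) : f ∈ Phi m k := by
  have : Nontrivial (Fin m) := Fin.nontrivial_iff_two_le.2 hm
  refine ⟨⟨hind.ne_const, fun i j => hind.ne, fun i j => hind.ne_not⟩, ?_, fun y z hyz => ?_,
    fun i => ?_⟩
  · rw [← Fintype.card_congr e, Fintype.card_fin]
  · obtain ⟨r, rfl⟩ := e.surjective y
    obtain ⟨s, rfl⟩ := e.surjective z
    have hrs : r ≠ s := by
      rintro rfl
      simp at hyz
    exact (hsep hrs).ne' hyz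
  · exact mem_lightColumns.1 ((comp_equiv_mem_lightColumns e).1 (hlight i))

theorem labelledMatrices_Phi_subset :
    labelledMatrices k (Phi m k) ⊆ (Fintype.piFinset fun _ : Fin m => lightColumns (Fin k)) := by
  rintro _ ⟨f, hf, e, rfl⟩
  exact mem_coe.2 <| Fintype.mem_piFinset.2 fun i =>
    (comp_equiv_mem_lightColumns e).2 (mem_lightColumns.2 (hf.2.2.2 i))

theorem mem_labelledMatrices_of_zeroIndependent (hm : 2 ≤ m) {A : Fin m → Fin k → Bool}
    (hlight : ∀ i, A i ∈ lightColumns (Fin k)) (hind : ZeroIndependent A)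
    (hsep : RowSeparated A) :
    A ∈ labelledMatrices k {f | f ∈ Phi m k ∧ ZeroIndependent (zeroColumn f)} := by
  obtain ⟨f, e, he⟩ := exists_equiv_zero_of_injective hsep.injective
  obtain rfl : A = fun i => zeroColumn f i ∘ e :=
    funext fun i => funext fun r => (congrFun (he r) i).symm
  have hf := hind.of_comp e
  exact ⟨f, ⟨mem_Phi_of_labelling hm e hlight hf hsep, hf⟩, e, rfl⟩

theorem ncard_Phi_mul_factorial_le :
    (Phi m k).ncard * k ! ≤ #(lightColumns (Fin k)) ^ m := by
  rw [← ncard_labelledMatrices fun f hf => hf.2.1]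
  refine (Set.ncard_le_ncard labelledMatrices_Phi_subset).trans_eq ?_
  rw [Set.ncard_coe_finset, Fintype.card_piFinset_const]

theorem card_lightColumns_pow_le (hm : 2 ≤ m) :
    (1 - (8 * (m : ℝ) ^ 2 * (3 / 4) ^ k + (k : ℝ) ^ 2 * m * (3 / 4) ^ (m - 1))) *
        (#(lightColumns (Fin k)) : ℝ) ^ m ≤
      {f | f ∈ Phi m k ∧ ZeroIndependent (zeroColumn f)}.ncard * k ! := by
  classical
  have : Nonempty (Fin m) := ⟨0, by omega⟩
  let all := Fintype.piFinset fun _ : Fin m => lightColumns (Fin k)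
  let good := labelledMatrices k {f | f ∈ Phi m k ∧ ZeroIndependent (zeroColumn f)}
  have cover : all ⊆ {A ∈ all | A ∈ good} ∪
      ({A ∈ all | ¬ ZeroIndependent A} ∪ {A ∈ all | ¬ RowSeparated A}) := by
    intro A hA
    have := mem_labelledMatrices_of_zeroIndependent hm (Fintype.mem_piFinset.1 hA)
    simp only [mem_union, mem_filter, hA, true_and, good]
    tauto
  have card_good : #{A ∈ all | A ∈ good} ≤
      {f | f ∈ Phi m k ∧ ZeroIndependent (zeroColumn f)}.ncard * k ! := by
    rw [← ncard_labelledMatrices fun f hf => hf.1.2.1, ← Set.ncard_coe_finset]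
    exact Set.ncard_le_ncard fun A hA => (mem_filter.1 hA).2
  have count : (#(lightColumns (Fin k)) : ℝ) ^ m ≤
      {f | f ∈ Phi m k ∧ ZeroIndependent (zeroColumn f)}.ncard * k ! +
        (#{A ∈ all | ¬ ZeroIndependent A} + #{A ∈ all | ¬ RowSeparated A}) := by
    have := (card_le_card cover).trans <| (card_union_le _ _).trans <|
      add_le_add card_good (card_union_le _ _)
    simp only [all, Fintype.card_piFinset_const] at this
    exact_mod_cast this
  have dependent := card_lightColumns_not_zeroIndependent_le (κ := Fin m) (ι := Fin k)
  have close := card_lightColumns_not_rowSeparated_le (κ := Fin m) (ι := Fin k)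
  simp only [Fintype.card_fin] at dependent close
  linarith

theorem ncard_zeroIndependent_ge {δ : ℝ} (hm : 2 ≤ m)
    (hδ : 8 * (m : ℝ) ^ 2 * (3 / 4) ^ k + (k : ℝ) ^ 2 * m * (3 / 4) ^ (m - 1) ≤ δ) :
    (1 - δ) * ((Phi m k).ncard : ℝ) ≤
      {f | f ∈ Phi m k ∧ ZeroIndependent (zeroColumn f)}.ncard := by
  rcases le_or_gt 1 δ with h1 | h1
  · exact (mul_nonpos_of_nonpos_of_nonneg (sub_nonpos.2 h1) (Nat.cast_nonneg _)).trans
      (Nat.cast_nonneg _)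
  have upper : ((Phi m k).ncard : ℝ) * k ! ≤ (#(lightColumns (Fin k)) : ℝ) ^ m := by
    exact_mod_cast ncard_Phi_mul_factorial_le
  refine le_of_mul_le_mul_right ?_ (Nat.cast_pos.2 k.factorial_pos : (0 : ℝ) < k !)
  calc (1 - δ) * ((Phi m k).ncard : ℝ) * k ! = (1 - δ) * ((Phi m k).ncard * k !) := mul_assoc _ _ _
    _ ≤ (1 - δ) * (#(lightColumns (Fin k)) : ℝ) ^ m :=
      mul_le_mul_of_nonneg_left upper (sub_nonneg.2 h1.le)
    _ ≤ _ := by gcongr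
    _ ≤ _ := card_lightColumns_pow_le hm

end Labellings

section AlmostAll

variable {R R' : ℕ → ℕ → Prop} {P Q : (m k : ℕ) → BoolFun m → Prop}

theorem AlmostAll.mono (h : AlmostAll R P) (hR : ∀ m k, R' m k → R m k)
    (hPQ : ∀ m k, R' m k → ∀ f ∈ Phi m k, P m k f → Q m k f) : AlmostAll R' Q := by
  intro δ hδ
  obtain ⟨M, hM⟩ := h δ hδ
  refine ⟨M, fun m k hm hk => (hM m k hm (hR m k hk)).trans ?_⟩
  have : {f | f ∈ Phi m k ∧ P m k f} ⊆ {f | f ∈ Phi m k ∧ Q m k f} :=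
    fun f hf => ⟨hf.1, hPQ m k hk f hf.1 hf.2⟩
  exact_mod_cast Set.ncard_le_ncard this

theorem AlmostAll.or (h : AlmostAll R P) (h' : AlmostAll R' P) :
    AlmostAll (fun m k => R m k ∨ R' m k) P := by
  intro δ hδ
  obtain ⟨M, hM⟩ := h δ hδ
  obtain ⟨M', hM'⟩ := h' δ hδ
  refine ⟨max M M', fun m k hm => ?_⟩
  exact Or.rec (hM m k (le_of_max_le_left hm)) (hM' m k (le_of_max_le_right hm))

theorem almostAll_of_forall (h : ∀ m k, R m k → ∀ f ∈ Phi m k, P m k f) : AlmostAll R P := by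
  refine fun δ hδ => ⟨0, fun m k _ hk => ?_⟩
  have : {f | f ∈ Phi m k ∧ P m k f} = Phi m k := Set.sep_eq_self_iff_mem_true.2 (h m k hk)
  rw [this]
  exact mul_le_of_le_one_left (Nat.cast_nonneg _) (by linarith)

theorem three_quarters_pow_le_inv_cube {m k : ℕ} (hm : 0 < m)
    (hk : Real.log (m : ℝ) ≤ (k : ℝ) / 12) : (3 / 4 : ℝ) ^ k ≤ ((m : ℝ) ^ 3)⁻¹ := by
  calc (3 / 4 : ℝ) ^ k ≤ Real.exp (-(1 / 4)) ^ k := by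
        gcongr
        linarith [Real.one_sub_le_exp_neg (1 / 4)]
    _ = Real.exp (-(k / 4)) := by
        rw [← Real.exp_nat_mul]
        ring_nf
    _ ≤ Real.exp (-(3 * Real.log m)) := Real.exp_le_exp.2 (by linarith)
    _ = ((m : ℝ) ^ 3)⁻¹ := by
        rw [Real.exp_neg, mul_comm, Real.exp_mul, Real.exp_log (by exact_mod_cast hm)]
        norm_cast

theorem tendsto_exceptional_fraction (C : ℝ) :
    Tendsto (fun m : ℕ => 8 / (m : ℝ) + C ^ 2 * (4 / 3) * ((m : ℝ) ^ 3 * (3 / 4) ^ m))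
      atTop (𝓝 0) := by
  simpa using (tendsto_const_div_atTop_nhds_zero_nat (8 : ℝ)).add
    ((tendsto_pow_const_mul_const_pow_of_abs_lt_one 3 (r := (3 / 4 : ℝ))
      (by norm_num [abs_lt])).const_mul (C ^ 2 * (4 / 3)))

theorem exceptional_fraction_le {C : ℝ} {m k : ℕ} (hm : 0 < m)
    (hlog : Real.log (m : ℝ) ≤ (k : ℝ) / 12) (hk : (k : ℝ) ≤ C * m) :
    8 * (m : ℝ) ^ 2 * (3 / 4) ^ k + (k : ℝ) ^ 2 * m * (3 / 4) ^ (m - 1) ≤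
      8 / (m : ℝ) + C ^ 2 * (4 / 3) * ((m : ℝ) ^ 3 * (3 / 4) ^ m) := by
  have hm' : (m : ℝ) ≠ 0 := by exact_mod_cast hm.ne'
  refine add_le_add ?_ ?_
  · calc 8 * (m : ℝ) ^ 2 * (3 / 4) ^ k ≤ 8 * (m : ℝ) ^ 2 * ((m : ℝ) ^ 3)⁻¹ := by
          gcongr
          exact three_quarters_pow_le_inv_cube hm hlog
      _ = 8 / (m : ℝ) := by field_simp
  · calc (k : ℝ) ^ 2 * m * (3 / 4) ^ (m - 1) ≤ (C * m) ^ 2 * m * (3 / 4) ^ (m - 1) := by gcongr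
      _ = C ^ 2 * (4 / 3) * ((m : ℝ) ^ 3 * (3 / 4 * (3 / 4) ^ (m - 1))) := by ring
      _ = _ := by rw [mul_pow_sub_one hm.ne']

theorem almostAll_zeroIndependent (C : ℝ) :
    AlmostAll (fun m k => Real.log (m : ℝ) ≤ (k : ℝ) / 12 ∧ (k : ℝ) ≤ C * m)
      (fun _ _ f => ZeroIndependent (zeroColumn f)) := by
  intro δ hδ
  obtain ⟨M, hM⟩ := eventually_atTop.1
    (((tendsto_exceptional_fraction C).eventually_le_const hδ).and (eventually_ge_atTop 2))
  refine ⟨M, fun m k hm ⟨hlog, hk⟩ => ?_⟩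
  obtain ⟨hfrac, hm2⟩ := hM m hm
  exact ncard_zeroIndependent_ge hm2 ((exceptional_fraction_le (by omega) hlog hk).trans hfrac)

theorem almostAll_three_mul_le_rank (C : ℝ) :
    AlmostAll (fun m k => Real.log (m : ℝ) ≤ (k : ℝ) / 12 ∧ (k : ℝ) ≤ C * m)
      (fun m _ f => ∀ D : DNF m, D.Realizes f → 3 * m ≤ D.rank) :=
  (almostAll_zeroIndependent C).mono (fun _ _ => id) fun _ _ _ _ hf hind _ hD =>
    hD.three_mul_le_rank hf.2.2.1 hf.1.not_constant hind

end AlmostAll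

section Lambda

variable {α : ℝ}

theorem lam_nonneg (hα : 0 ≤ α) (m k : ℕ) : 0 ≤ lam α m k :=
  mul_nonneg hα (Real.sqrt_nonneg _)

theorem lam_le_of_log_le (hα : α ≤ 1) {c : ℝ} (hc : 0 ≤ c) {m k : ℕ}
    (h : 2 * Real.log m ≤ c ^ 2 * k) : lam α m k ≤ c := by
  have sqrt_le : Real.sqrt (2 * Real.log m / k) ≤ c :=
    (Real.sqrt_le_left hc).2 (div_le_of_le_mul₀ (Nat.cast_nonneg k) (sq_nonneg c) h)
  exact (mul_le_of_le_one_left (Real.sqrt_nonneg _) hα).trans sqrt_le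

variable {x t : ℝ}

theorem literal_bound_le_two_mul (hx : 0 ≤ x) (ht0 : 0 ≤ t) (ht : t ≤ 1 / 17) :
    10 / 3 * x - 13 * x * (1 - t) / (9 + 3 * t) ≤ 2 * x := by
  have : 4 / 3 * x ≤ 13 * x * (1 - t) / (9 + 3 * t) := by
    rw [le_div_iff₀ (by linarith)]
    nlinarith
  linarith

theorem literal_bound_le_three_mul (hx : 0 ≤ x) (ht0 : 0 ≤ t) (ht : t ≤ 1 / 2) :
    10 / 3 * x - 13 * x * (1 - t) / (9 + 3 * t) ≤ 3 * x := by
  have : 1 / 3 * x ≤ 13 * x * (1 - t) / (9 + 3 * t) := by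
    rw [le_div_iff₀ (by linarith)]
    nlinarith
  linarith

theorem literal_bound_le_literal_bound (hx : 0 ≤ x) (ht0 : 0 ≤ t) (ht : t ≤ 1 / 4) :
    10 / 3 * x - 5 * x * (1 - t) / (3 + 3 * t) ≤ 10 / 3 * x - 13 * x * (1 - t) / (9 + 3 * t) := by
  have : 13 * x * (1 - t) / (9 + 3 * t) ≤ 5 * x * (1 - t) / (3 + 3 * t) := by
    rw [div_le_div_iff₀ (by linarith) (by linarith)]
    have : 0 ≤ x * (1 - t) * (1 - 4 * t) :=
      mul_nonneg (mul_nonneg hx (by linarith)) (by linarith)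
    linarith
  linarith

end Lambda

end DNFBound

open DNFBound in
theorem mainTheorem2_general (α : ℝ) (hα0 : 0 ≤ α) (hα1 : α ≤ 1) :
    AlmostAll (fun m k => Real.log (m : ℝ) ≤ (k : ℝ) / 12)
      (fun m k f => ∀ D : DNF m, D.Realizes f →
        10 / 3 * (m : ℝ) - 13 * (m : ℝ) * (1 - lam α m k) / (9 + 3 * lam α m k) ≤ D.rank) := by
  have sparse := almostAll_of_forall (R := fun m k => 578 * Real.log (m : ℝ) ≤ k)
    (P := fun m k f => ∀ D : DNF m, D.Realizes f →
      10 / 3 * (m : ℝ) - 13 * (m : ℝ) * (1 - lam α m k) / (9 + 3 * lam α m k) ≤ D.rank)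
    fun m k hk f hf D hD =>
      (literal_bound_le_two_mul m.cast_nonneg (lam_nonneg hα0 m k)
        (lam_le_of_log_le hα1 (by norm_num) (by linarith))).trans
      (by exact_mod_cast hD.two_mul_le_rank hf.2.2.1 hf.1.not_constant)
  refine (sparse.or ((almostAll_three_mul_le_rank 578).mono (fun m k => id)
    fun m k hk f _ hrank D hD => ?_)).mono (fun m k hk => ?_) fun m k _ f _ => id
  · exact (literal_bound_le_three_mul m.cast_nonneg (lam_nonneg hα0 m k)
      (lam_le_of_log_le hα1 (by norm_num) (by linarith [hk.1]))).trans
      (by exact_mod_cast hrank D hD)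
  · have := Real.log_le_self (Nat.cast_nonneg m : (0 : ℝ) ≤ m)
    rcases le_total (578 * Real.log (m : ℝ)) k with h | h
    · exact Or.inl h
    · exact Or.inr ⟨hk, by linarith⟩

theorem mainTheorem2 (α : ℝ) (hα0 : 0 < α) (hα1 : α < 1) :
    DNFBound.AlmostAll
      (fun m k => Real.log (m : ℝ) ≤ (k : ℝ) / 32)
      (fun m k f => ∀ D : DNFBound.DNF m, DNFBound.DNF.IsMinimal D f →
        10 / 3 * (m : ℝ)
            - 5 * (m : ℝ) * (1 - DNFBound.lam α m k) / (3 + 3 * DNFBound.lam α m k)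
          ≤ (DNFBound.DNF.rank D : ℝ)) ∧
    DNFBound.AlmostAll
      (fun m k => (k : ℝ) / 162 < Real.log (m : ℝ) ∧ Real.log (m : ℝ) < (k : ℝ) / 32)
      (fun m k f => ∀ D : DNFBound.DNF m, DNFBound.DNF.IsMinimal D f →
        10 / 3 * (m : ℝ)
            - 13 * (m : ℝ) * (1 - DNFBound.lam α m k) / (9 + 3 * DNFBound.lam α m k)
          ≤ (DNFBound.DNF.rank D : ℝ)) := by
  open DNFBound in
  have general := mainTheorem2_general α hα0.le hα1.le
  refine ⟨general.mono (fun m k hk => hk.trans (by gcongr; norm_num)) fun m k hk f _ h D hD => ?_,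
    general.mono (fun m k hk => hk.2.le.trans (by gcongr; norm_num)) fun m k _ f _ h D hD =>
      h D hD.1⟩
  exact (literal_bound_le_literal_bound m.cast_nonneg (lam_nonneg hα0.le m k)
    (lam_le_of_log_le hα1.le (by norm_num) (by linarith))).trans (h D hD.1)
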